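/- Consider the CONGEST model: the nodes of a connected undirected graph on $n$ nodes with unique ids in $\{1,\dots,n\}$ (each node initially knowing $n$, its own id, its neighbours' ids and a random seed, with unlimited local computation) communicate in synchronous rounds, and in each round every node may send a message of at most $B$ bits to each of its neighbours. Let $D$ denote the diameter of the graph. There is an absolute constant $s$ such that for every $\varepsilon>0$ and every constant $\beta$ there is a constant $R=R(\varepsilon,\beta)$ with the following property. For every $c$ there are $C=C(\varepsilon,\beta,c)>0$ and $N=N(\varepsilon,\beta,c)$ such that for all $n\ge N$ and all $B\le c\log n$: if a (possibly randomized, even with randomness shared by all nodes) CONGEST algorithm with $B$-bit messages has the property that on every connected $n$-node graph with at most $s\,n$ edges and diameter at most $R$, with probability at least $2/3$, after $T$ rounds every node holds a value $\hat D$ with $$D\le \hat D\le \left(\tfrac32-\varepsilon\right)D+\beta,$$ then $T\ge C\,n/\log^3 n$. In other words, computing a $(3/2-\varepsilon)$-approximation of the diameter, even with a constant additive error, requires $\Omega(n/\log^3 n)$ rounds in the CONGEST model, even on sparse graphs (with $O(n)$ edges) of constant diameter, and even for randomized algorithms. -/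

import Mathlib

universe u v

/-- Messages of at most `B` bits. The empty bit string stands for "no message". -/
abbrev CongestMessage (B : ℕ) : Type := {l : List Bool // l.length ≤ B}

/-- The empty message. -/
def CongestMessage.empty (B : ℕ) : CongestMessage B := ⟨[], Nat.zero_le B⟩

/-- A (randomized) algorithm in the CONGEST model for `n`-node networks with bandwidth `B` bits per
edge, direction and round. The nodes are identified with their unique ids, i.e. with `Fin n`.
At the beginning a node knows `n`, its own id, the ids of its neighbours, and the random
seed `ω : Ω`. Local memory and local computation are unrestricted.

The seed is visible to all nodes (shared randomness). Private randomness is the special case in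
which `Ω` is a product over the nodes, with the product measure, and `init ω v` uses only
the `v`-th component of `ω`; a deterministic algorithm is one in which `init` ignores `ω`. -/
structure CongestAlgorithm (Ω : Type u) (n B : ℕ) where
  /-- the local states of a node -/
  State : Type v
  /-- the initial state, from the seed, the node's own id and the ids of its neighbours -/
  init : Ω → Fin n → Set (Fin n) → State
  /-- the message that a node in the given state sends to its neighbour with the given id -/
  send : State → Fin n → CongestMessage B
  /-- the new state, from the old state and the messages received, indexed by the sender -/
  receive : State → (Fin n → CongestMessage B) → State
  /-- the value that a node in the given state holds as its output -/
  output : State → ℝ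

namespace CongestAlgorithm

variable {Ω : Type*} {n B : ℕ}

open Classical in
/-- The state of each node after `t` synchronous rounds on the network `G` with seed `ω`. In every
round each node sends one message to each of its neighbours; nothing arrives from
nodes that are not neighbours. -/
noncomputable def stateAfter (A : CongestAlgorithm Ω n B) (G : SimpleGraph (Fin n)) (ω : Ω) :
    ℕ → Fin n → A.State
  | 0, v => A.init ω v (G.neighborSet v)
  | t + 1, v => A.receive (stateAfter A G ω t v) fun u =>
      if G.Adj u v then A.send (stateAfter A G ω t u) v else CongestMessage.empty B

/-- `d` is an `α`-approximation of the diameter `D` of `G` up to an additive error `β`: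
`D ≤ d ≤ α D + β`. -/
def IsDiamApprox {V : Type*} (G : SimpleGraph V) (α β d : ℝ) : Prop :=
  (G.diam : ℝ) ≤ d ∧ d ≤ α * (G.diam : ℝ) + β

/-- On every network of the class `𝒢`, with probability at least `2/3` over the seed, after `T` rounds
every node holds an `α`-approximation of the diameter up to an additive error `β`.
(If an algorithm stops before round `T`, its nodes keep their states from then on.) -/
def ApproximatesDiam [MeasurableSpace Ω] (A : CongestAlgorithm Ω n B)
    (μ : MeasureTheory.Measure Ω) (T : ℕ) (α β : ℝ) (𝒢 : Set (SimpleGraph (Fin n))) : Prop :=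
  ∀ G ∈ 𝒢, ∃ S : Set Ω, MeasurableSet S ∧ 2 / 3 ≤ μ S ∧
    ∀ ω ∈ S, ∀ v : Fin n, IsDiamApprox G α β (A.output (A.stateAfter G ω T v))

end CongestAlgorithm

/-- The connected graphs on `n` nodes with at most `s * n` edges and diameter at most `R`. -/
def sparseNetworks (s R n : ℕ) : Set (SimpleGraph (Fin n)) :=
  {G | G.Connected ∧ G.edgeSet.ncard ≤ s * n ∧ G.diam ≤ R}

open Finset

/-! The bound is a reduction from set disjointness on `2 ^ L - 1` bits. The two inputs are hidden on
the two sides of a cut with only `O(L)` edges, in a graph with `O(P L 2 ^ L)` nodes and constant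
diameter. Disjoint inputs give diameter at most `4 P + 8`, intersecting ones at least `6 P + 4`
(`diam_network_le_of_disjoint`, `le_diam_network_of_not_disjoint`). For `P` large in terms of `ε`
and `β`, an approximation separates the two cases.

For a fixed seed the messages crossing the cut form a transcript with the rectangle property
(`cutTranscript_rectangle`), of `O(T B L)` bits. By `card_le_log_card_transcripts`, deciding
disjointness takes a number of bits linear in the input length, hence `T B L = Ω(2 ^ L)`. With `n ≈
P L 2 ^ L` and `B = O(log n)` this is `T = Ω(n / log³ n)`.

The disjointness bound is the information-theoretic one. On a random disjoint pair, a short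
transcript is, on average over `i`, nearly independent of the `i`-th bit (`level_one_inequality`).
So setting one bit at `i` barely moves the transcript's distribution, and by cut and paste
(`hellinger_cut_paste`) neither does setting both, although this changes the answer. -/

/-! ### Level-one inequality, entropy and Hellinger distance. -/

/-- The sign `±1` of a bit. -/
def bitSign (b : Bool) : ℝ := if b then 1 else -1

theorem sum_prod_exp_bitSign {ι : Type*} [Fintype ι] [DecidableEq ι] (c : ι → ℝ) :
    ∑ w : ι → Bool, Real.exp (∑ i, c i * bitSign (w i)) = ∏ i, (2 * Real.cosh (c i)) := by
  simp_rw [Real.exp_sum]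
  rw [← Fintype.prod_sum (fun i b => Real.exp (c i * bitSign b))]
  refine Finset.prod_congr rfl fun i _ => ?_
  rw [Fintype.sum_bool, Real.cosh_eq]
  simp [bitSign]
  ring

/-- The level-one inequality for subsets of the Boolean cube. -/
theorem level_one_inequality {ι : Type*} [Fintype ι] [DecidableEq ι] (S : Finset (ι → Bool))
    (hS : S.Nonempty) :
    ∑ i, (∑ w ∈ S, bitSign (w i)) ^ 2 ≤
      2 * (#S : ℝ) ^ 2 * Real.log (2 ^ Fintype.card ι / #S) := by
  have hpos : (0 : ℝ) < #S := by exact_mod_cast hS.card_pos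
  set c : ι → ℝ := fun i => (∑ w ∈ S, bitSign (w i)) / #S with hc
  set q := ∑ i, c i ^ 2 with hq
  -- With `c` the mean sign vector of `S`, the mean over `S` of `⟨c, w⟩` is `|c|² = q`. Jensen and
  -- the sub-Gaussian bound on the whole cube give `exp q ≤ 2 ^ |ι| / |S| * exp (q / 2)`.
  have hjensen : Real.exp q ≤
      ∑ w ∈ S, (#S : ℝ)⁻¹ * Real.exp (∑ i, c i * bitSign (w i)) := by
    have h := convexOn_exp.map_sum_le (t := S) (w := fun _ => (#S : ℝ)⁻¹)
      (p := fun w => ∑ i, c i * bitSign (w i)) (fun _ _ => by positivity)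
      (by simp [hpos.ne']) (fun _ _ => Set.mem_univ _)
    simp only [smul_eq_mul] at h
    refine le_trans (le_of_eq ?_) h
    congr 1
    rw [← Finset.mul_sum, Finset.sum_comm, hq, Finset.mul_sum]
    refine Finset.sum_congr rfl fun i _ => ?_
    rw [← Finset.mul_sum]
    simp only [hc]
    field_simp
  have hsub : ∑ w ∈ S, Real.exp (∑ i, c i * bitSign (w i)) ≤
      2 ^ Fintype.card ι * Real.exp (q / 2) := by
    calc _ ≤ ∑ w : ι → Bool, Real.exp (∑ i, c i * bitSign (w i)) :=
          Finset.sum_le_sum_of_subset_of_nonneg (Finset.subset_univ _)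
            fun _ _ _ => (Real.exp_pos _).le
      _ = ∏ i, (2 * Real.cosh (c i)) := sum_prod_exp_bitSign c
      _ ≤ ∏ i, (2 * Real.exp (c i ^ 2 / 2)) :=
          Finset.prod_le_prod (fun i _ => by positivity)
            fun i _ => by have := Real.cosh_le_exp_half_sq (c i); linarith
      _ = _ := by
          rw [Finset.prod_mul_distrib, ← Real.exp_sum, hq, Finset.sum_div]
          simp
  rw [← Finset.mul_sum] at hjensen
  have h1 : Real.exp (q / 2) ≤ 2 ^ Fintype.card ι / #S := by
    have h2 : Real.exp (q / 2) * Real.exp (q / 2) ≤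
        2 ^ Fintype.card ι / #S * Real.exp (q / 2) := by
      rw [← Real.exp_add, add_halves]
      calc _ ≤ _ := hjensen
        _ ≤ (#S : ℝ)⁻¹ * (2 ^ Fintype.card ι * Real.exp (q / 2)) := by gcongr
        _ = _ := by ring
    exact le_of_mul_le_mul_right h2 (Real.exp_pos _)
  have h2 : q / 2 ≤ Real.log (2 ^ Fintype.card ι / #S) :=
    (Real.le_log_iff_exp_le (by positivity)).2 h1
  have h3 : ∑ i, (∑ w ∈ S, bitSign (w i)) ^ 2 = (#S : ℝ) ^ 2 * q := by
    rw [hq, Finset.mul_sum]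
    refine Finset.sum_congr rfl fun i _ => ?_
    simp only [hc]
    field_simp
  rw [h3]
  nlinarith [sq_nonneg (#S : ℝ)]

/-- The entropy of a partition into `|Z|` parts is at most `log |Z|`. -/
theorem sum_mul_log_div_le {Z : Type*} [Fintype Z] (a : Z → ℝ) (ha : ∀ z, 0 ≤ a z) {N : ℝ}
    (hN : 0 < N) (hsum : ∑ z, a z = N) :
    ∑ z, a z * Real.log (N / a z) ≤ N * Real.log (Fintype.card Z) := by
  have hne : Nonempty Z := by
    by_contra h
    rw [not_nonempty_iff] at h
    simp at hsum
    linarith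
  have hc : (0 : ℝ) < Fintype.card Z := by exact_mod_cast Fintype.card_pos
  -- The tangent bound `log x ≤ x - 1` at the uniform distribution; the correction terms sum to
  -- zero.
  have key : ∀ z, a z * Real.log (N / a z) ≤
      a z * Real.log (Fintype.card Z) + (N / Fintype.card Z - a z) := by
    intro z
    rcases (ha z).eq_or_lt with h | h
    · rw [← h]; simp; positivity
    · have h1 := Real.log_le_sub_one_of_pos (x := N / a z / Fintype.card Z) (by positivity)
      rw [Real.log_div (by positivity) hc.ne'] at h1
      have h2 := mul_le_mul_of_nonneg_left h1 h.le
      have h3 : a z * (N / a z / Fintype.card Z - 1) = N / Fintype.card Z - a z := by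
        field_simp
      linarith
  refine (Finset.sum_le_sum fun z _ => key z).trans ?_
  rw [Finset.sum_add_distrib, ← Finset.sum_mul, Finset.sum_sub_distrib, hsum]
  simp
  field_simp
  simp

theorem sq_sqrt_sub_sqrt_le {a b : ℝ} (ha : 0 ≤ a) (hb : 0 ≤ b) :
    (√a - √b) ^ 2 ≤ (a - b) ^ 2 / (a + b) := by
  rcases (add_nonneg ha hb).eq_or_lt with h | h
  · have : a = 0 := by linarith
    have : b = 0 := by linarith
    subst a b
    simp
  · rw [le_div_iff₀ h]
    have h1 : a - b = (√a - √b) * (√a + √b) := by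
      nlinarith [Real.sq_sqrt ha, Real.sq_sqrt hb]
    have h2 : a + b ≤ (√a + √b) ^ 2 := by
      nlinarith [Real.sq_sqrt ha, Real.sq_sqrt hb, mul_nonneg (Real.sqrt_nonneg a) (Real.sqrt_nonneg b)]
    rw [h1, mul_pow]
    exact mul_le_mul_of_nonneg_left h2 (sq_nonneg _)

/-- Cut and paste for squared Hellinger distances: if `a e = b c` pointwise and all four functions
have the same mass, then `a` and `e` are as far from each other as `b` and `c`. -/
theorem hellinger_cut_paste {Z : Type*} [Fintype Z] {a b c e : Z → ℝ} {N : ℝ}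
    (ha : ∀ z, 0 ≤ a z) (hb : ∀ z, 0 ≤ b z) (hc : ∀ z, 0 ≤ c z) (he : ∀ z, 0 ≤ e z)
    (hprod : ∀ z, a z * e z = b z * c z) (hsa : ∑ z, a z = N) (hsb : ∑ z, b z = N)
    (hsc : ∑ z, c z = N) (hse : ∑ z, e z = N) :
    ∑ z, (√(a z) - √(e z)) ^ 2 ≤
      2 * ∑ z, (√(a z) - √(b z)) ^ 2 + 2 * ∑ z, (√(a z) - √(c z)) ^ 2 := by
  have hexp : ∀ f g : Z → ℝ, (∀ z, 0 ≤ f z) → (∀ z, 0 ≤ g z) →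
      ∑ z, (√(f z) - √(g z)) ^ 2 = ∑ z, f z + ∑ z, g z - 2 * ∑ z, √(f z * g z) := by
    intro f g hf hg
    rw [Finset.mul_sum, ← Finset.sum_add_distrib, ← Finset.sum_sub_distrib]
    refine Finset.sum_congr rfl fun z _ => ?_
    rw [Real.sqrt_mul (hf z), sub_sq, Real.sq_sqrt (hf z), Real.sq_sqrt (hg z)]
    ring
  -- For equal masses the distance depends only on the affinity `∑ √(a e)`, hence only on the
  -- pointwise product.
  have h1 : ∑ z, (√(a z) - √(e z)) ^ 2 = ∑ z, (√(b z) - √(c z)) ^ 2 := by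
    rw [hexp a e ha he, hexp b c hb hc]
    simp_rw [hprod]
    rw [hsa, hsb, hsc, hse]
  rw [h1, Finset.mul_sum, Finset.mul_sum, ← Finset.sum_add_distrib]
  refine Finset.sum_le_sum fun z _ => ?_
  nlinarith [sq_nonneg ((√(a z) - √(b z)) + (√(a z) - √(c z)))]

/-- AM-GM on `|a - e| = |√a - √e| (√a + √e)`, weighted so that the mass term `N / 6` stays below the
advantage `N / 3` of a protocol with error `1/3`. -/
theorem sum_sub_le_hellinger {Z : Type*} [Fintype Z] {a e : Z → ℝ} {N : ℝ}
    (ha : ∀ z, 0 ≤ a z) (he : ∀ z, 0 ≤ e z) (hsa : ∑ z, a z = N) (hse : ∑ z, e z = N)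
    (D : Finset Z) :
    ∑ z ∈ D, (a z - e z) ≤ 6 * ∑ z, (√(a z) - √(e z)) ^ 2 + N / 6 := by
  have key : ∀ z, |a z - e z| ≤ 6 * (√(a z) - √(e z)) ^ 2 + (a z + e z) / 12 := by
    intro z
    have h1 : a z - e z = (√(a z) - √(e z)) * (√(a z) + √(e z)) := by
      nlinarith [Real.sq_sqrt (ha z), Real.sq_sqrt (he z)]
    have h2 : (√(a z) + √(e z)) ^ 2 ≤ 2 * (a z + e z) := by
      nlinarith [Real.sq_sqrt (ha z), Real.sq_sqrt (he z), sq_nonneg (√(a z) - √(e z))]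
    rw [abs_le]
    constructor
    · nlinarith [sq_nonneg (12 * (√(a z) - √(e z)) + (√(a z) + √(e z)))]
    · nlinarith [sq_nonneg (12 * (√(a z) - √(e z)) - (√(a z) + √(e z)))]
  calc ∑ z ∈ D, (a z - e z) ≤ ∑ z ∈ D, |a z - e z| := Finset.sum_le_sum fun _ _ => le_abs_self _
    _ ≤ ∑ z, |a z - e z| := Finset.sum_le_sum_of_subset_of_nonneg (Finset.subset_univ _)
          fun _ _ _ => abs_nonneg _
    _ ≤ ∑ z, (6 * (√(a z) - √(e z)) ^ 2 + (a z + e z) / 12) :=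
          Finset.sum_le_sum fun z _ => key z
    _ = _ := by
          rw [Finset.sum_add_distrib, ← Finset.mul_sum, ← Finset.sum_div, Finset.sum_add_distrib,
            hsa, hse]
          ring

/-! ### Communication lower bound for set disjointness. -/

section Disjointness

variable {ι Z : Type*} [Fintype ι] [DecidableEq ι] [Fintype Z] [DecidableEq Z]

theorem sum_update_true_add_update_false (f : (ι → Bool) → ℝ) (i : ι) :
    ∑ w, (f (Function.update w i true) + f (Function.update w i false)) = 2 * ∑ w, f w := by
  have h1 : ∀ w : ι → Bool, f (Function.update w i true) + f (Function.update w i false) =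
      f w + f (Function.update w i (!w i)) := by
    intro w
    cases hw : w i
    · have : Function.update w i false = w := by rw [← hw, Function.update_eq_self]
      rw [this, add_comm]; rfl
    · have : Function.update w i true = w := by rw [← hw, Function.update_eq_self]
      rw [this]; rfl
  have hinv : Function.Involutive fun w : ι → Bool => Function.update w i (!w i) := by
    intro w
    simp
  have h2 : ∑ w, f (Function.update w i (!w i)) = ∑ w, f w :=
    Equiv.sum_comp hinv.toPerm f
  simp_rw [h1]
  rw [Finset.sum_add_distrib, h2]
  ring

/-- The number of points that `F` sends to `z` after their `i`-th bit has been set to `u`. -/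
def fiberCount (F : (ι → Bool) → Z) (i : ι) (u : Bool) (z : Z) : ℝ :=
  ∑ w, if F (Function.update w i u) = z then 1 else 0

omit [Fintype Z] in
theorem fiberCount_nonneg (F : (ι → Bool) → Z) (i : ι) (u : Bool) (z : Z) :
    0 ≤ fiberCount F i u z :=
  Finset.sum_nonneg fun _ _ => by split_ifs <;> norm_num

/-- A map to a small set reveals little about a typical bit. On the fibre over `z` the two counts
sum to `2 |S z|` and differ by twice the sign sum, so the level-one inequality bounds the fibre's
share by its entropy term. -/
theorem sum_hellinger_fiberCount_le (F : (ι → Bool) → Z) :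
    ∑ i, ∑ z, (√(fiberCount F i false z) - √(fiberCount F i true z)) ^ 2 ≤
      4 * (2 ^ Fintype.card ι * Real.log (Fintype.card Z)) := by
  set S : Z → Finset (ι → Bool) := fun z => univ.filter fun w => F w = z with hS
  have hadd : ∀ i z, fiberCount F i false z + fiberCount F i true z = 2 * #(S z) := by
    intro i z
    have h := sum_update_true_add_update_false (fun w => if F w = z then (1 : ℝ) else 0) i
    rw [Finset.sum_add_distrib] at h
    rw [fiberCount, fiberCount, add_comm, h]
    simp [hS]
  have hsub : ∀ i z, fiberCount F i true z - fiberCount F i false z =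
      2 * ∑ w ∈ S z, bitSign (w i) := by
    intro i z
    have h := sum_update_true_add_update_false
      (fun w => if F w = z then bitSign (w i) else 0) i
    rw [Finset.sum_add_distrib] at h
    simp only [Function.update_self] at h
    rw [hS, Finset.sum_filter, ← h, fiberCount, fiberCount, ← Finset.sum_sub_distrib,
      ← Finset.sum_add_distrib]
    refine Finset.sum_congr rfl fun w _ => ?_
    split_ifs <;> simp [bitSign]
  have hz : ∀ z, ∑ i, (√(fiberCount F i false z) - √(fiberCount F i true z)) ^ 2 ≤
      4 * ((#(S z) : ℝ) * Real.log (2 ^ Fintype.card ι / #(S z))) := by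
    intro z
    have h1 : ∑ i, (√(fiberCount F i false z) - √(fiberCount F i true z)) ^ 2 ≤
        ∑ i, 2 * (∑ w ∈ S z, bitSign (w i)) ^ 2 / #(S z) := by
      refine Finset.sum_le_sum fun i _ => ?_
      refine (sq_sqrt_sub_sqrt_le (fiberCount_nonneg ..) (fiberCount_nonneg ..)).trans ?_
      rw [hadd, ← neg_sub, hsub, neg_sq]
      rcases (S z).eq_empty_or_nonempty with h | h
      · simp [h]
      · have : (0 : ℝ) < #(S z) := by exact_mod_cast h.card_pos
        refine le_of_eq ?_
        field_simp
    refine h1.trans ?_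
    rw [← Finset.sum_div, ← Finset.mul_sum]
    rcases (S z).eq_empty_or_nonempty with h | h
    · simp [h]
    · have hp : (0 : ℝ) < #(S z) := by exact_mod_cast h.card_pos
      rw [div_le_iff₀ hp]
      nlinarith [level_one_inequality (S z) h]
  rw [Finset.sum_comm]
  refine (Finset.sum_le_sum fun z _ => hz z).trans ?_
  rw [← Finset.mul_sum]
  refine mul_le_mul_of_nonneg_left ?_ (by norm_num)
  refine sum_mul_log_div_le _ (fun _ => by positivity) (by positivity) ?_
  have h := Finset.card_eq_sum_card_fiberwise (f := F) (s := univ) (t := univ) (by simp)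
  rw [← Nat.cast_sum, ← h]
  simp

/-- The first input of a disjoint pair: the bits of `w` selected by `d`. -/
def selectBits (d w : ι → Bool) : ι → Bool := fun i => d i && w i

/-- The second input of a disjoint pair: the bits of `w` that `d` does not select. -/
def rejectBits (d w : ι → Bool) : ι → Bool := fun i => !d i && w i

/-- The number of `w` for which the pair of inputs given by `d` and `w`, with `i`-th
bits replaced by `u` and `v`, has transcript `z`. -/
def transcriptCount (tr : (ι → Bool) → (ι → Bool) → Z) (i : ι) (d : ι → Bool) (u v : Bool)
    (z : Z) : ℝ :=
  ∑ w, if tr (Function.update (selectBits d w) i u) (Function.update (rejectBits d w) i v) = z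
    then 1 else 0

variable (tr : (ι → Bool) → (ι → Bool) → Z)

omit [Fintype Z] in
theorem transcriptCount_nonneg (i : ι) (d : ι → Bool) (u v : Bool) (z : Z) :
    0 ≤ transcriptCount tr i d u v z :=
  Finset.sum_nonneg fun _ _ => by split_ifs <;> norm_num

omit [Fintype Z] in
theorem sum_transcriptCount (i : ι) (d : ι → Bool) (u v : Bool) (D : Finset Z) :
    ∑ z ∈ D, transcriptCount tr i d u v z = ∑ w, if tr (Function.update (selectBits d w) i u)
      (Function.update (rejectBits d w) i v) ∈ D then (1 : ℝ) else 0 := by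
  simp only [transcriptCount]
  rw [Finset.sum_comm]
  refine Finset.sum_congr rfl fun w _ => ?_
  simp

theorem sum_univ_transcriptCount (i : ι) (d : ι → Bool) (u v : Bool) :
    ∑ z, transcriptCount tr i d u v z = 2 ^ Fintype.card ι := by
  rw [sum_transcriptCount]
  simp

omit [Fintype Z] in
-- Both inputs are overwritten at `i`, so `d i` is irrelevant. It may therefore be chosen to decide
-- which player's bit is toggled.
theorem transcriptCount_update (i : ι) (d : ι → Bool) (b u v : Bool) (z : Z) :
    transcriptCount tr i (Function.update d i b) u v z = transcriptCount tr i d u v z := by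
  simp only [transcriptCount]
  refine Finset.sum_congr rfl fun w _ => ?_
  have h1 : Function.update (selectBits (Function.update d i b) w) i u =
      Function.update (selectBits d w) i u := by
    ext j
    by_cases h : j = i
    · subst h; simp
    · simp [h, selectBits]
  have h2 : Function.update (rejectBits (Function.update d i b) w) i v =
      Function.update (rejectBits d w) i v := by
    ext j
    by_cases h : j = i
    · subst h; simp
    · simp [h, rejectBits]
  rw [h1, h2]

omit [Fintype Z] in
theorem fiberCount_eq_transcriptCount (i : ι) (d : ι → Bool) (u : Bool) (z : Z) :
    fiberCount (fun w => tr (selectBits d w) (rejectBits d w)) i u z =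
      transcriptCount tr i d (d i && u) (!d i && u) z := by
  simp only [transcriptCount, fiberCount]
  refine Finset.sum_congr rfl fun w _ => ?_
  have h1 : selectBits d (Function.update w i u) =
      Function.update (selectBits d w) i (d i && u) := by
    ext j
    by_cases h : j = i
    · subst h; simp [selectBits]
    · simp [h, selectBits]
  have h2 : rejectBits d (Function.update w i u) =
      Function.update (rejectBits d w) i (!d i && u) := by
    ext j
    by_cases h : j = i
    · subst h; simp [rejectBits]
    · simp [h, rejectBits]
  simp only [h1, h2]

variable {tr}

omit [Fintype Z] in
-- For fixed `d` the two inputs are independent. Exchanging the rejected parts of two samples is an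
-- involution that keeps the first inputs and swaps the second ones; the rectangle property then
-- matches the two products.
theorem transcriptCount_mul (hrect : ∀ x y x' y', tr x y = tr x' y' → tr x y' = tr x y)
    (i : ι) (d : ι → Bool) (z : Z) :
    transcriptCount tr i d false false z * transcriptCount tr i d true true z =
      transcriptCount tr i d false true z * transcriptCount tr i d true false z := by
  set swap : (ι → Bool) × (ι → Bool) → (ι → Bool) × (ι → Bool) := fun p =>
    (fun j => if d j then p.1 j else p.2 j, fun j => if d j then p.2 j else p.1 j) with hswap
  have hinv : Function.Involutive swap := by
    intro p
    ext j <;> simp only [hswap] <;> split_ifs <;> rfl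
  have hs1 : ∀ p, selectBits d (swap p).1 = selectBits d p.1 := by
    intro p; ext j; simp only [hswap, selectBits]; cases d j <;> simp
  have hs2 : ∀ p, selectBits d (swap p).2 = selectBits d p.2 := by
    intro p; ext j; simp only [hswap, selectBits]; cases d j <;> simp
  have hr1 : ∀ p, rejectBits d (swap p).1 = rejectBits d p.2 := by
    intro p; ext j; simp only [hswap, rejectBits]; cases d j <;> simp
  have hr2 : ∀ p, rejectBits d (swap p).2 = rejectBits d p.1 := by
    intro p; ext j; simp only [hswap, rejectBits]; cases d j <;> simp
  simp only [transcriptCount]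
  rw [Finset.sum_mul_sum, Finset.sum_mul_sum, ← Finset.sum_product', ← Finset.sum_product']
  simp only [Finset.univ_product_univ]
  rw [← Equiv.sum_comp hinv.toPerm]
  refine Finset.sum_congr rfl fun p _ => ?_
  simp only [Function.Involutive.coe_toPerm, hs1, hs2, hr1, hr2]
  generalize Function.update (selectBits d p.1) i false = x
  generalize Function.update (selectBits d p.2) i true = x'
  generalize Function.update (rejectBits d p.2) i false = y
  generalize Function.update (rejectBits d p.1) i true = y'
  have hiff : tr x y = z ∧ tr x' y' = z ↔ tr x y' = z ∧ tr x' y = z := by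
    constructor
    · rintro ⟨h1, h2⟩
      exact ⟨(hrect _ _ _ _ (h1.trans h2.symm)).trans h1,
        (hrect _ _ _ _ (h2.trans h1.symm)).trans h2⟩
    · rintro ⟨h1, h2⟩
      exact ⟨(hrect _ _ _ _ (h1.trans h2.symm)).trans h1,
        (hrect _ _ _ _ (h2.trans h1.symm)).trans h2⟩
  by_cases h : tr x y = z ∧ tr x' y' = z
  · have h' := hiff.1 h
    simp [h.1, h.2, h'.1, h'.2]
  · have h' := mt hiff.2 h
    rw [not_and_or] at h h'
    rcases h with h | h <;> rcases h' with h' | h' <;> simp [h, h']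

/-- Given `d i`, the `i`-th bit of `w` toggles exactly one player's input, so the right side
measures the moves from `(0,0)` to `(1,0)` and to `(0,1)`. One factor 2 comes from averaging over `d
i`, the other from cut and paste. -/
theorem sum_hellinger_transcriptCount_le
    (hrect : ∀ x y x' y', tr x y = tr x' y' → tr x y' = tr x y) (i : ι) :
    ∑ d, ∑ z, (√(transcriptCount tr i d false false z) -
        √(transcriptCount tr i d true true z)) ^ 2 ≤
      4 * ∑ d : ι → Bool, ∑ z,
        (√(fiberCount (fun w => tr (selectBits d w) (rejectBits d w)) i false z) -
          √(fiberCount (fun w => tr (selectBits d w) (rejectBits d w)) i true z)) ^ 2 := by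
  have h := sum_update_true_add_update_false (fun d : ι → Bool => ∑ z,
        (√(fiberCount (fun w => tr (selectBits d w) (rejectBits d w)) i false z) -
          √(fiberCount (fun w => tr (selectBits d w) (rejectBits d w)) i true z)) ^ 2) i
  rw [show (4 : ℝ) = 2 * 2 by norm_num, mul_assoc, ← h, Finset.mul_sum]
  refine Finset.sum_le_sum fun d _ => ?_
  simp only [fiberCount_eq_transcriptCount, Function.update_self, transcriptCount_update]
  simp only [Bool.true_and, Bool.false_and, Bool.not_true, Bool.not_false, Bool.and_false]
  have := hellinger_cut_paste (transcriptCount_nonneg tr i d false false)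
    (transcriptCount_nonneg tr i d false true) (transcriptCount_nonneg tr i d true false)
    (transcriptCount_nonneg tr i d true true) (transcriptCount_mul hrect i d)
    (sum_univ_transcriptCount tr i d _ _) (sum_univ_transcriptCount tr i d _ _)
    (sum_univ_transcriptCount tr i d _ _) (sum_univ_transcriptCount tr i d _ _)
  linarith

/-- The distributional lower bound for set disjointness: if a family of transcripts with the
rectangle property decides disjointness with error at most `1/3` on average over the hard
distribution, then there are exponentially many transcripts. -/
theorem card_le_log_card_transcripts
    (hrect : ∀ x y x' y', tr x y = tr x' y' → tr x y' = tr x y) (D : Finset Z)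
    (hcorrect : 4 / 3 * (Fintype.card ι * (2 ^ Fintype.card ι * 2 ^ Fintype.card ι) : ℝ) ≤
      ∑ i : ι, ∑ d : ι → Bool, ∑ w : ι → Bool,
        ((if tr (Function.update (selectBits d w) i false)
            (Function.update (rejectBits d w) i false) ∈ D then (1 : ℝ) else 0) +
          if tr (Function.update (selectBits d w) i true)
            (Function.update (rejectBits d w) i true) ∉ D then (1 : ℝ) else 0)) :
    (Fintype.card ι : ℝ) ≤ 576 * Real.log (Fintype.card Z) := by
  set N : ℝ := 2 ^ Fintype.card ι with hN
  have hNpos : 0 < N := by positivity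
  have h1 : ∀ i d, ∑ w : ι → Bool,
        ((if tr (Function.update (selectBits d w) i false)
            (Function.update (rejectBits d w) i false) ∈ D then (1 : ℝ) else 0) +
          if tr (Function.update (selectBits d w) i true)
            (Function.update (rejectBits d w) i true) ∉ D then (1 : ℝ) else 0) ≤
      6 * ∑ z, (√(transcriptCount tr i d false false z) -
        √(transcriptCount tr i d true true z)) ^ 2 + 7 / 6 * N := by
    intro i d
    have hc := sum_transcriptCount tr i d true true Dᶜ
    simp only [Finset.mem_compl] at hc
    rw [Finset.sum_add_distrib, ← hc, ← sum_transcriptCount]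
    have h2 := sum_sub_le_hellinger (transcriptCount_nonneg tr i d false false)
      (transcriptCount_nonneg tr i d true true) (sum_univ_transcriptCount tr i d _ _)
      (sum_univ_transcriptCount tr i d _ _) D
    rw [Finset.sum_sub_distrib] at h2
    have h3 := Finset.sum_add_sum_compl D (transcriptCount tr i d true true)
    rw [sum_univ_transcriptCount] at h3
    linarith
  have h2 := hcorrect.trans (Finset.sum_le_sum fun i _ => Finset.sum_le_sum fun d _ => h1 i d)
  simp only [Finset.sum_add_distrib, ← Finset.mul_sum] at h2
  have h3 := Finset.sum_le_sum fun i (_ : i ∈ univ) => sum_hellinger_transcriptCount_le hrect i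
  rw [← Finset.mul_sum, Finset.sum_comm (s := univ (α := ι)) (t := univ (α := ι → Bool))
    (f := fun i d => ∑ z,
        (√(fiberCount (fun w => tr (selectBits d w) (rejectBits d w)) i false z) -
          √(fiberCount (fun w => tr (selectBits d w) (rejectBits d w)) i true z)) ^ 2)] at h3
  have h4 := Finset.sum_le_sum fun d (_ : d ∈ univ (α := ι → Bool)) =>
    sum_hellinger_fiberCount_le fun w => tr (selectBits d w) (rejectBits d w)
  simp only [Finset.sum_const, Finset.card_univ, Fintype.card_fun, Fintype.card_bool,
    nsmul_eq_mul, Nat.cast_pow, Nat.cast_ofNat] at h2 h4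
  rw [← hN] at h2 h4
  -- The advantage is `4/3 - 7/6 = 1/6`, and `576 = 6 * (6 * 4 * 4)`.
  have h5 : (Fintype.card ι : ℝ) * (N * N) ≤
      576 * Real.log (Fintype.card Z) * (N * N) := by linarith
  exact le_of_mul_le_mul_right h5 (by positivity)

end Disjointness

/-! ### Edge counts, distances and diameters. -/

section GraphLemmas

variable {V V' : Type*}

theorem ncard_edgeSet_le_of_adj_imp [Fintype V] (G : SimpleGraph V) (f g : V → V)
    (h : ∀ u v, G.Adj u v → v = f u ∨ v = g u ∨ u = f v ∨ u = g v) :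
    G.edgeSet.ncard ≤ 2 * Fintype.card V := by
  have hsub : G.edgeSet ⊆ Set.range (fun v => s(v, f v)) ∪ Set.range (fun v => s(v, g v)) := by
    intro e
    induction e with
    | _ u v =>
      intro he
      rcases h u v he with h | h | h | h
      · exact Or.inl ⟨u, by rw [h]⟩
      · exact Or.inr ⟨u, by rw [h]⟩
      · exact Or.inl ⟨v, by rw [h, Sym2.eq_swap]⟩
      · exact Or.inr ⟨v, by rw [h, Sym2.eq_swap]⟩
  have hr : ∀ k : V → Sym2 V, (Set.range k).ncard ≤ Fintype.card V := by
    intro k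
    rw [← Set.image_univ, ← Nat.card_eq_fintype_card, ← Set.ncard_univ]
    exact Set.ncard_image_le
  refine (Set.ncard_le_ncard hsub).trans ((Set.ncard_union_le _ _).trans ?_)
  have := hr (fun v => s(v, f v))
  have := hr (fun v => s(v, g v))
  omega

theorem edist_le_edist_of_hom {G : SimpleGraph V} {G' : SimpleGraph V'} (φ : G →g G') (u v : V) :
    G'.edist (φ u) (φ v) ≤ G.edist u v := by
  by_cases h : G.edist u v = ⊤
  · rw [h]; exact le_top
  · obtain ⟨p, hp⟩ := SimpleGraph.exists_walk_of_edist_ne_top h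
    rw [← hp, ← SimpleGraph.Walk.length_map φ p]
    exact SimpleGraph.edist_le _

theorem ediam_comap_equiv (G : SimpleGraph V) (e : V' ≃ V) : (G.comap e).ediam = G.ediam := by
  refine le_antisymm ?_ ?_
  · refine SimpleGraph.ediam_le_of_edist_le fun u v => ?_
    have h := edist_le_edist_of_hom (SimpleGraph.Iso.comap e G).symm.toHom (e u) (e v)
    have h' : (G.comap e).edist u v ≤ G.edist (e u) (e v) := by simpa using h
    exact h'.trans SimpleGraph.edist_le_ediam
  · refine SimpleGraph.ediam_le_of_edist_le fun u v => ?_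
    have h := edist_le_edist_of_hom (SimpleGraph.Iso.comap e G).toHom (e.symm u) (e.symm v)
    have h' : G.edist u v ≤ (G.comap e).edist (e.symm u) (e.symm v) := by simpa using h
    exact h'.trans SimpleGraph.edist_le_ediam

theorem sub_le_length_of_lipschitz {G : SimpleGraph V} (φ : V → ℤ)
    (h : ∀ u v, G.Adj u v → |φ u - φ v| ≤ 1) {u v : V} (p : G.Walk u v) :
    φ v - φ u ≤ p.length := by
  induction p with
  | nil => simp
  | cons ha p ih =>
    have := abs_le.1 (h _ _ ha)
    rw [SimpleGraph.Walk.length_cons]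
    push_cast
    linarith [this.1]

/-- The tool for lower bounds on the diameter: a 1-Lipschitz potential telescopes along a shortest
walk. -/
theorem sub_le_diam_of_lipschitz {G : SimpleGraph V} (hG : G.ediam ≠ ⊤) (φ : V → ℤ)
    (h : ∀ u v, G.Adj u v → |φ u - φ v| ≤ 1) (u v : V) : φ v - φ u ≤ G.diam := by
  have hr : G.Reachable u v := SimpleGraph.preconnected_of_ediam_ne_top hG u v
  obtain ⟨p, hp⟩ := hr.exists_walk_length_eq_dist
  have h1 := sub_le_length_of_lipschitz φ h p
  have h2 : G.dist u v ≤ G.diam := SimpleGraph.dist_le_diam hG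
  omega

theorem edist_trans_le {G : SimpleGraph V} {u v w : V} {a b c : ℕ} (h1 : G.edist u v ≤ a)
    (h2 : G.edist v w ≤ b) (h : a + b ≤ c) : G.edist u w ≤ c := by
  refine (G.edist_triangle (v := v)).trans ((add_le_add h1 h2).trans ?_)
  exact_mod_cast h

end GraphLemmas

/-! ### The spider graph and its diameter. -/

/-- The nodes of the lower bound graph: on either side `s` there are spiders, one for each index
`i < 2 ^ L`, whose legs are paths with `P` nodes, and two hubs for each of the bits `0, …, L`.
There are `W` padding nodes. -/
inductive SpiderNode (L P W : ℕ) : Type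
  | centre (s : Bool) (i : Fin (2 ^ L)) : SpiderNode L P W
  | leg (s : Bool) (i : Fin (2 ^ L)) (j : Fin (L + 2)) (p : Fin P) : SpiderNode L P W
  | hub (s : Bool) (j : Fin (L + 1)) (b : Bool) : SpiderNode L P W
  | pad (q : Fin W) : SpiderNode L P W

namespace SpiderNode

variable {L P W : ℕ}

/-- The nodes as a sum type. -/
def equivSum (L P W : ℕ) : SpiderNode L P W ≃
    (Bool × Fin (2 ^ L)) ⊕ (Bool × Fin (2 ^ L) × Fin (L + 2) × Fin P) ⊕
      (Bool × Fin (L + 1) × Bool) ⊕ Fin W where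
  toFun
    | centre s i => .inl (s, i)
    | leg s i j p => .inr (.inl (s, i, j, p))
    | hub s j b => .inr (.inr (.inl (s, j, b)))
    | pad q => .inr (.inr (.inr q))
  invFun
    | .inl (s, i) => centre s i
    | .inr (.inl (s, i, j, p)) => leg s i j p
    | .inr (.inr (.inl (s, j, b))) => hub s j b
    | .inr (.inr (.inr q)) => pad q
  left_inv v := by cases v <;> rfl
  right_inv v := by rcases v with _ | _ | _ | _ <;> rfl

/-- The hub for bit `j` to which the `j`-th leg of spider `i` on side `s` leads. -/
def hubBit (s : Bool) (i j : ℕ) : Bool := xor s (i.testBit j)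

/-- The first parent: legs point towards the centres of the spiders, centres of spiders that are
not marked to spider `0`, hubs to their twins, padding nodes to a fixed centre. -/
def parent (z : Bool → Fin (2 ^ L) → Bool) : SpiderNode L P W → SpiderNode L P W
  | centre s i => if z s i then centre s i else centre s 0
  | leg s i j p => if (p : ℕ) = 0 then centre s i else leg s i j ⟨p - 1, by omega⟩
  | hub s j b => hub (!s) j b
  | pad _ => centre false 0

/-- The second parent: the last node of every leg but the tail points to a hub, and the centres of
the two spiders `0` to each other. -/
def parent' : SpiderNode L P W → SpiderNode L P W
  | centre s i => if i = 0 then centre (!s) 0 else centre s i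
  | leg s i j p => if h : (p : ℕ) + 1 = P ∧ (j : ℕ) < L + 1 then
      hub s ⟨j, h.2⟩ (hubBit s i j) else leg s i j p
  | hub s j b => hub s j b
  | pad q => pad q

/-- The lower bound graph. -/
def graph (L P W : ℕ) (z : Bool → Fin (2 ^ L) → Bool) : SimpleGraph (SpiderNode L P W) :=
  SimpleGraph.fromRel fun u v => v = parent z u ∨ v = parent' u

theorem adj_imp {z : Bool → Fin (2 ^ L) → Bool} {u v : SpiderNode L P W}
    (h : (graph L P W z).Adj u v) :
    v = parent z u ∨ v = parent' u ∨ u = parent z v ∨ u = parent' v := by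
  rw [graph, SimpleGraph.fromRel_adj] at h
  tauto

section Distances

variable (z : Bool → Fin (2 ^ L) → Bool)

/-- Distance at most one rather than adjacency: a node that is its own parent encodes a missing
edge, since `SimpleGraph.fromRel` drops loops. -/
theorem edist_parent_le (v : SpiderNode L P W) :
    (graph L P W z).edist v (parent z v) ≤ (1 : ℕ) := by
  rw [Nat.cast_one, SimpleGraph.edist_le_one_iff_adj_or_eq, graph, SimpleGraph.fromRel_adj]
  tauto

theorem edist_parent'_le (v : SpiderNode L P W) :
    (graph L P W z).edist v (parent' v) ≤ (1 : ℕ) := by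
  rw [Nat.cast_one, SimpleGraph.edist_le_one_iff_adj_or_eq, graph, SimpleGraph.fromRel_adj]
  tauto

theorem edist_leg_centre_le (s : Bool) (i : Fin (2 ^ L)) (j : Fin (L + 2)) (p : ℕ) (hp : p < P) :
    (graph L P W z).edist (leg s i j ⟨p, hp⟩) (centre s i) ≤ ((p + 1 : ℕ) : ℕ∞) := by
  induction p with
  | zero => simpa [parent] using edist_parent_le z (leg (W := W) s i j ⟨0, hp⟩)
  | succ p ih =>
    have h := edist_parent_le z (leg (W := W) s i j ⟨p + 1, hp⟩)
    simp only [parent, Nat.add_sub_cancel, Nat.succ_ne_zero, if_false] at h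
    exact edist_trans_le h (ih (by omega)) (by omega)

theorem edist_hub_centre_le (hP : 0 < P) (s : Bool) (i : Fin (2 ^ L)) (j : Fin (L + 1)) (b : Bool)
    (hb : b = hubBit s i j) :
    (graph L P W z).edist (hub s j b) (centre s i) ≤ ((P + 1 : ℕ) : ℕ∞) := by
  have h := edist_parent'_le z (leg (W := W) s i j.castSucc ⟨P - 1, Nat.sub_lt hP one_pos⟩)
  have h1 : P - 1 + 1 = P ∧ (j : ℕ) < L + 1 := ⟨by omega, j.2⟩
  simp only [parent', Fin.val_castSucc, h1, Fin.eta, ← hb] at h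
  rw [SimpleGraph.edist_comm] at h
  exact edist_trans_le h (edist_leg_centre_le z s i j.castSucc (P - 1) (Nat.sub_lt hP one_pos)) (by omega)

/-- Bit `L` vanishes for every index, so all spiders of one side share a hub there. -/
theorem edist_centre_centre_same_le (hP : 0 < P) (s : Bool) (i i' : Fin (2 ^ L)) :
    (graph L P W z).edist (centre s i) (centre s i') ≤ ((2 * (P + 1) : ℕ) : ℕ∞) := by
  have h := edist_hub_centre_le (W := W) z hP s i (Fin.last L) s
    (by simp [hubBit, Nat.testBit_lt_two_pow i.2])
  have h' := edist_hub_centre_le (W := W) z hP s i' (Fin.last L) s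
    (by simp [hubBit, Nat.testBit_lt_two_pow i'.2])
  rw [SimpleGraph.edist_comm] at h
  exact edist_trans_le h h' (by omega)

theorem edist_centre_zero_zero_le (s : Bool) :
    (graph L P W z).edist (centre s 0) (centre (!s) 0) ≤ (1 : ℕ) := by
  simpa [parent'] using edist_parent'_le z (centre (P := P) (W := W) s 0)

/-- The `xor` with the side in `hubBit` makes opposite spiders reach twin hubs exactly at the bits
where their indices differ. Only equal indices lack this shortcut. -/
theorem edist_centre_centre_opposite_le (hP : 0 < P) (s : Bool) (i i' : Fin (2 ^ L))
    (h : i ≠ i') :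
    (graph L P W z).edist (centre s i) (centre (!s) i') ≤ ((2 * (P + 1) + 1 : ℕ) : ℕ∞) := by
  obtain ⟨j, hj⟩ := Nat.exists_testBit_ne_of_ne (fun hh => h (Fin.ext hh))
  have hjL : j < L := by
    by_contra hjL
    push Not at hjL
    have hpow : 2 ^ L ≤ 2 ^ j := Nat.pow_le_pow_right (by norm_num) hjL
    exact hj (by rw [Nat.testBit_lt_two_pow (i.2.trans_le hpow),
      Nat.testBit_lt_two_pow (i'.2.trans_le hpow)])
  set b := hubBit s i j with hb
  have h1 := edist_hub_centre_le (W := W) z hP s i ⟨j, by omega⟩ b hb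
  have h2 := edist_hub_centre_le (W := W) z hP (!s) i' ⟨j, by omega⟩ b (by
    revert hj
    simp only [hb, hubBit]
    cases s <;> cases (i : ℕ).testBit j <;> cases (i' : ℕ).testBit j <;> simp)
  have h3 := edist_parent_le z (hub (P := P) (W := W) s ⟨j, by omega⟩ b)
  rw [SimpleGraph.edist_comm] at h1
  exact edist_trans_le h1 (edist_trans_le (c := P + 2) h3 h2 (by omega)) (by omega)

theorem exists_edist_centre_le (hP : 0 < P) (v : SpiderNode L P W) :
    ∃ s i, (graph L P W z).edist v (centre s i) ≤ ((P + 2 : ℕ) : ℕ∞) := by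
  cases v with
  | centre s i => exact ⟨s, i, by simp⟩
  | leg s i j p =>
    refine ⟨s, i, (edist_leg_centre_le z s i j p p.2).trans ?_⟩
    exact_mod_cast by omega
  | hub s j b =>
    have h := edist_parent_le z (hub (P := P) (W := W) s j b)
    -- All bits of `0` vanish, so spider `0` on side `s` reaches the hubs with `b = s`; any other
    -- hub has a twin reached by the opposite spider `0`.
    by_cases hbs : b = s
    · refine ⟨s, 0, (edist_hub_centre_le z hP s 0 j b (by simp [hubBit, hbs])).trans ?_⟩
      exact_mod_cast by omega
    · refine ⟨!s, 0, edist_trans_le h (edist_hub_centre_le z hP (!s) 0 j b ?_) (by omega)⟩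
      simp only [hubBit, Fin.val_zero, Nat.zero_testBit]
      cases s <;> cases b <;> simp_all
  | pad q =>
    refine ⟨false, 0, (edist_parent_le z (pad q)).trans ?_⟩
    exact_mod_cast by omega

theorem ediam_le_of_centres (hP : 0 < P) {k : ℕ}
    (h : ∀ s i s' i', (graph L P W z).edist (centre s i) (centre s' i') ≤ k) :
    (graph L P W z).ediam ≤ ((k + 2 * (P + 2) : ℕ) : ℕ∞) := by
  refine SimpleGraph.ediam_le_of_edist_le fun u v => ?_
  obtain ⟨s, i, hu⟩ := exists_edist_centre_le z hP u
  obtain ⟨s', i', hv⟩ := exists_edist_centre_le z hP v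
  rw [SimpleGraph.edist_comm] at hv
  exact edist_trans_le hu (edist_trans_le (h s i s' i') hv le_rfl) (by omega)

theorem ediam_le (hP : 0 < P) : (graph L P W z).ediam ≤ ((6 * P + 9 : ℕ) : ℕ∞) := by
  refine (ediam_le_of_centres z hP (k := 4 * P + 5) fun s i s' i' => ?_).trans ?_
  · have h1 := edist_centre_centre_same_le (W := W) z hP s i 0
    have h2 := edist_centre_centre_same_le (W := W) z hP s' 0 i'
    have h3 := edist_centre_zero_zero_le (P := P) (W := W) z s
    by_cases hs : s' = s
    · subst hs
      exact edist_trans_le h1 h2 (by omega)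
    · have : s' = !s := by cases s <;> cases s' <;> simp_all
      subst this
      exact edist_trans_le h1 (edist_trans_le h3 h2 le_rfl) (by omega)
  · exact_mod_cast by omega

/-- If the marked sets are disjoint then the diameter is small. -/
theorem ediam_le_of_disjoint (hP : 0 < P) (hz : ∀ i, z false i = false ∨ z true i = false) :
    (graph L P W z).ediam ≤ ((4 * P + 8 : ℕ) : ℕ∞) := by
  -- An unmarked centre takes one step to spider `0`, one across the cut, and `2 (P + 1)` steps
  -- through the common hub.
  have key : ∀ s i, z s i = false → (graph L P W z).edist (centre s i) (centre (!s) i) ≤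
      ((2 * P + 4 : ℕ) : ℕ∞) := by
    intro s i h
    have h1 := edist_parent_le z (centre (P := P) (W := W) s i)
    simp only [parent, h, Bool.false_eq_true, if_false] at h1
    have h2 := edist_centre_zero_zero_le (P := P) (W := W) z s
    have h3 := edist_centre_centre_same_le (W := W) z hP (!s) 0 i
    exact edist_trans_le h1 (edist_trans_le h2 h3 le_rfl) (by omega)
  refine (ediam_le_of_centres z hP (k := 2 * P + 4) fun s i s' i' => ?_).trans ?_
  · by_cases hs : s' = s
    · subst hs
      refine (edist_centre_centre_same_le z hP s' i i').trans ?_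
      exact_mod_cast by omega
    · have : s' = !s := by cases s <;> cases s' <;> simp_all
      subst this
      by_cases hi : i = i'
      · subst hi
        by_cases h : z s i = false
        · exact key s i h
        · have h' : z (!s) i = false := by
            rcases hz i with h0 | h0 <;> cases s <;> simp_all
          have := key (!s) i h'
          rwa [Bool.not_not, SimpleGraph.edist_comm] at this
      · refine (edist_centre_centre_opposite_le z hP s i i' hi).trans ?_
        exact_mod_cast by omega
  · exact_mod_cast by omega

/-- The potential of the centres. -/
def centrePotential (P : ℕ) (i₀ : Fin (2 ^ L)) (s : Bool) (i : Fin (2 ^ L)) : ℤ :=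
  if i = i₀ then (if s then 4 * (P + 1) else 0) else 2 * (P + 1)

/-- The slope of the potential along the legs. -/
def legSlope (i₀ : Fin (2 ^ L)) (s : Bool) (i : Fin (2 ^ L)) (j : ℕ) : ℤ :=
  if j < L + 1 then
    (if i = i₀ then (if s then -1 else 1)
      else if hubBit s i j = (i₀ : ℕ).testBit j then -1 else 1)
  else if i = i₀ then (if s then 1 else -1) else 0

/-- A potential that changes by at most one along edges and grows by `6 P + 4` between the
ends of the tails of the two spiders with index `i₀`, if both are marked. -/
def potential (i₀ : Fin (2 ^ L)) : SpiderNode L P W → ℤ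
  | centre s i => centrePotential P i₀ s i
  | leg s i j p => centrePotential P i₀ s i + legSlope i₀ s i j * (p + 1)
  | hub _ j b => if b = (i₀ : ℕ).testBit j then P + 1 else 3 * (P + 1)
  | pad _ => 2 * (P + 1)

theorem abs_legSlope_le (i₀ : Fin (2 ^ L)) (s : Bool) (i : Fin (2 ^ L)) (j : ℕ) :
    |legSlope i₀ s i j| ≤ 1 := by
  unfold legSlope
  split_ifs <;> simp

/-- Continued one step beyond its last node, each leg but the tail reaches the potential of its hub.
-/
theorem centrePotential_add (i₀ : Fin (2 ^ L)) (s : Bool) (i : Fin (2 ^ L)) {j : ℕ}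
    (hj : j < L + 1) : centrePotential P i₀ s i + legSlope i₀ s i j * (P + 1) =
      if hubBit s i j = (i₀ : ℕ).testBit j then (P : ℤ) + 1 else 3 * (P + 1) := by
  unfold centrePotential legSlope
  rw [if_pos hj]
  by_cases h : i = i₀
  · subst h
    cases s
    · simp [hubBit]
    · simp [hubBit]
      ring
  · simp only [h, if_false]
    split_ifs <;> ring

variable {z}

/-- The marks matter only here: they remove the edges from the centres `i₀` to the centres `0`,
across which the potential would jump by `2 (P + 1)`. -/
theorem abs_potential_sub_parent_le {i₀ : Fin (2 ^ L)} (h0 : i₀ ≠ 0) (hz : ∀ s, z s i₀ = true)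
    (v : SpiderNode L P W) : |potential i₀ v - potential i₀ (parent z v)| ≤ 1 := by
  cases v with
  | centre s i =>
    simp only [parent]
    by_cases hi : i = i₀
    · subst hi; simp [hz]
    · split_ifs
      · simp
      · simp [potential, centrePotential, hi, h0.symm]
  | leg s i j p =>
    have h1 := abs_legSlope_le i₀ s i j
    simp only [parent]
    split_ifs with hp
    · simpa [potential, hp] using h1
    · have hp' : (((p : ℕ) - 1 : ℕ) : ℤ) = p - 1 := by omega
      simp only [potential, hp']
      refine le_trans (le_of_eq ?_) h1
      congr 1
      ring
  | hub s j b => simp [parent, potential]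
  | pad q => simp [parent, potential, centrePotential, h0.symm]

theorem abs_potential_sub_parent'_le {i₀ : Fin (2 ^ L)} (h0 : i₀ ≠ 0) (v : SpiderNode L P W) :
    |potential i₀ v - potential i₀ (parent' v)| ≤ 1 := by
  cases v with
  | centre s i =>
    simp only [parent']
    split_ifs with h
    · subst h; simp [potential, centrePotential, h0.symm]
    · simp
  | leg s i j p =>
    have h1 := abs_legSlope_le i₀ s i j
    simp only [parent']
    split_ifs with hp
    · have hp' : (P : ℤ) = p + 1 := by omega
      simp only [potential]
      rw [← centrePotential_add i₀ s i hp.2, hp', abs_sub_comm]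
      refine le_trans (le_of_eq ?_) h1
      congr 1
      ring
    · simp
  | hub s j b => simp [parent']
  | pad q => simp [parent']

/-- If the marked sets intersect outside `0` then the diameter is large. -/
theorem le_diam_of_not_disjoint (hP : 0 < P) {i₀ : Fin (2 ^ L)} (h0 : i₀ ≠ 0)
    (hz : ∀ s, z s i₀ = true) : 6 * P + 4 ≤ (graph L P W z).diam := by
  have hlip : ∀ u v, (graph L P W z).Adj u v → |potential i₀ u - potential i₀ v| ≤ 1 := by
    intro u v h
    rcases adj_imp h with rfl | rfl | rfl | rfl
    · exact abs_potential_sub_parent_le h0 hz _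
    · exact abs_potential_sub_parent'_le h0 _
    · rw [abs_sub_comm]; exact abs_potential_sub_parent_le h0 hz _
    · rw [abs_sub_comm]; exact abs_potential_sub_parent'_le h0 _
  -- Needed because `diam` takes the value `0` when `ediam` is infinite.
  have htop : (graph L P W z).ediam ≠ ⊤ :=
    ne_top_of_le_ne_top (ENat.natCast_ne_top _) (ediam_le z hP)
  have h := sub_le_diam_of_lipschitz htop (potential i₀) hlip
    (leg false i₀ (Fin.last _) ⟨P - 1, by omega⟩) (leg true i₀ (Fin.last _) ⟨P - 1, by omega⟩)
  have hp' : ((P - 1 : ℕ) : ℤ) = P - 1 := by omega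
  simp [potential, centrePotential, legSlope, hp'] at h
  omega

end Distances

end SpiderNode

/-! ### Simulation across a cut and reduction from disjointness. -/

namespace CongestMessage

/-- A message as a bit vector together with its length. -/
def toSigma (B : ℕ) (m : CongestMessage B) : Σ k : Fin (B + 1), List.Vector Bool k :=
  ⟨⟨m.1.length, Nat.lt_succ_of_le m.2⟩, ⟨m.1, rfl⟩⟩

theorem toSigma_injective (B : ℕ) : Function.Injective (toSigma B) := by
  have h : Function.LeftInverse
      (fun p : Σ k : Fin (B + 1), List.Vector Bool k =>
        (⟨p.2.1, by rw [p.2.2]; exact Nat.le_of_lt_succ p.1.2⟩ : CongestMessage B))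
      (toSigma B) := fun _ => rfl
  exact h.injective

noncomputable instance (B : ℕ) : Fintype (CongestMessage B) :=
  Fintype.ofInjective _ (toSigma_injective B)

theorem card_le (B : ℕ) : Fintype.card (CongestMessage B) ≤ 2 ^ (B + 1) := by
  refine (Fintype.card_le_of_injective _ (toSigma_injective B)).trans ?_
  rw [Fintype.card_sigma]
  simp only [card_vector, Fintype.card_bool]
  rw [Fin.sum_univ_eq_sum_range (fun k => 2 ^ k), Nat.geomSum_eq le_rfl]
  simp

end CongestMessage

namespace CongestAlgorithm

section Simulation

variable {Ω : Type*} {n B : ℕ} {X Y K : Type*}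

/-- The messages that are sent over a cut in the first `T` rounds. -/
noncomputable def cutTranscript (A : CongestAlgorithm Ω n B) (ω : Ω) (T : ℕ)
    (G : X → Y → SimpleGraph (Fin n)) (cut : K → Fin n × Fin n) (x : X) (y : Y) :
    Fin T → K → CongestMessage B :=
  fun t k => A.send (A.stateAfter (G x y) ω t (cut k).1) (cut k).2

/-- A family of networks in which the edges on either side of a cut depend on one of two
inputs only, and the edges across the cut are fixed and listed by `cut`. -/
structure IsCutFamily (G : X → Y → SimpleGraph (Fin n)) (side : Fin n → Bool)
    (cut : K → Fin n × Fin n) : Prop where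
  left : ∀ x y y' u v, side u = false → side v = false → ((G x y).Adj u v ↔ (G x y').Adj u v)
  right : ∀ x x' y u v, side u = true → side v = true → ((G x y).Adj u v ↔ (G x' y).Adj u v)
  across : ∀ x y x' y' u v, side u ≠ side v → ((G x y).Adj u v ↔ (G x' y').Adj u v)
  exists_cut : ∀ x y u v, side u ≠ side v → (G x y).Adj u v → ∃ k, cut k = (u, v)

variable {G : X → Y → SimpleGraph (Fin n)} {side : Fin n → Bool} {cut : K → Fin n × Fin n}

/-- If two runs have the same transcript, then in the mixed run either side behaves as
in the run from which its input stems. -/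
theorem stateAfter_of_cutTranscript_eq (A : CongestAlgorithm Ω n B) (ω : Ω) {T : ℕ}
    (h : IsCutFamily G side cut) {x x' : X} {y y' : Y}
    (heq : A.cutTranscript ω T G cut x y = A.cutTranscript ω T G cut x' y') (t : ℕ) (ht : t ≤ T) :
    (∀ v, side v = false → A.stateAfter (G x y') ω t v = A.stateAfter (G x y) ω t v) ∧
      ∀ v, side v = true → A.stateAfter (G x y') ω t v = A.stateAfter (G x' y') ω t v := by
  have hadjL : ∀ u v, side v = false → ((G x y').Adj u v ↔ (G x y).Adj u v) := by
    intro u v hv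
    by_cases hu : side u = false
    · exact h.left _ _ _ _ _ hu hv
    · exact h.across _ _ _ _ _ _ (by rw [hv]; exact hu)
  have hadjR : ∀ u v, side v = true → ((G x y').Adj u v ↔ (G x' y').Adj u v) := by
    intro u v hv
    by_cases hu : side u = true
    · exact h.right _ _ _ _ _ hu hv
    · exact h.across _ _ _ _ _ _ (by rw [hv]; exact hu)
  induction t with
  | zero =>
    constructor
    · intro v hv
      simp only [stateAfter]
      congr 1
      ext u
      rw [SimpleGraph.mem_neighborSet, SimpleGraph.mem_neighborSet, SimpleGraph.adj_comm,
        hadjL u v hv, SimpleGraph.adj_comm]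
    · intro v hv
      simp only [stateAfter]
      congr 1
      ext u
      rw [SimpleGraph.mem_neighborSet, SimpleGraph.mem_neighborSet, SimpleGraph.adj_comm,
        hadjR u v hv, SimpleGraph.adj_comm]
  | succ t ih =>
    obtain ⟨ihL, ihR⟩ := ih (by omega)
    have hmsg : ∀ u v, side u ≠ side v → (G x y').Adj u v →
        A.send (A.stateAfter (G x y) ω t u) v = A.send (A.stateAfter (G x' y') ω t u) v := by
      intro u v huv hadj
      obtain ⟨k, hk⟩ := h.exists_cut _ _ _ _ huv hadj
      have := congrFun (congrFun heq ⟨t, by omega⟩) k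
      simpa [cutTranscript, hk] using this
    constructor
    · intro v hv
      simp only [stateAfter]
      rw [ihL v hv]
      congr 1
      funext u
      have hif := hadjL u v hv
      by_cases hadj : (G x y).Adj u v
      · rw [if_pos hadj, if_pos (hif.2 hadj)]
        by_cases hu : side u = false
        · rw [ihL u hu]
        · rw [ihR u (by simpa using hu)]
          exact (hmsg u v (by rw [hv]; exact hu) ((hadjL u v hv).2 hadj)).symm
      · rw [if_neg hadj, if_neg (mt hif.1 hadj)]
    · intro v hv
      simp only [stateAfter]
      rw [ihR v hv]
      congr 1
      funext u
      have hif := hadjR u v hv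
      by_cases hadj : (G x' y').Adj u v
      · rw [if_pos hadj, if_pos (hif.2 hadj)]
        by_cases hu : side u = true
        · rw [ihR u hu]
        · rw [ihL u (by simpa using hu)]
          exact hmsg u v (by rw [hv]; exact hu) ((hadjR u v hv).2 hadj)
      · rw [if_neg hadj, if_neg (mt hif.1 hadj)]

/-- In the mixed run each sender behaves as in one of the two original runs, and these agree on all
cut messages. -/
theorem cutTranscript_rectangle (A : CongestAlgorithm Ω n B) (ω : Ω) {T : ℕ}
    (h : IsCutFamily G side cut) {x x' : X} {y y' : Y}
    (heq : A.cutTranscript ω T G cut x y = A.cutTranscript ω T G cut x' y') :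
    A.cutTranscript ω T G cut x y' = A.cutTranscript ω T G cut x y := by
  funext t k
  obtain ⟨hL, hR⟩ := stateAfter_of_cutTranscript_eq A ω h heq t t.2.le
  have hk := congrFun (congrFun heq t) k
  simp only [cutTranscript] at hk ⊢
  by_cases hu : side (cut k).1 = false
  · rw [hL _ hu]
  · rw [hR _ (by simpa using hu), hk]

end Simulation

/-- Among finitely many events of probability at least `2/3`, at least two thirds occur
simultaneously at some point. -/
theorem exists_two_thirds_le_sum_indicator {Ω J : Type*} [MeasurableSpace Ω]
    (μ : MeasureTheory.Measure Ω) [MeasureTheory.IsProbabilityMeasure μ] [Fintype J]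
    (S : J → Set Ω) (hS : ∀ j, MeasurableSet (S j)) (hμ : ∀ j, 2 / 3 ≤ μ (S j)) :
    ∃ ω, 2 / 3 * (Fintype.card J : ℝ) ≤ ∑ j, (S j).indicator (fun _ => (1 : ℝ)) ω := by
  have hint : ∀ j ∈ univ (α := J), MeasureTheory.Integrable ((S j).indicator fun _ => (1 : ℝ)) μ :=
    fun j _ => (MeasureTheory.integrable_const 1).indicator (hS j)
  obtain ⟨ω, hω⟩ := MeasureTheory.exists_integral_le (MeasureTheory.integrable_finsetSum univ hint)
  refine ⟨ω, le_trans ?_ hω⟩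
  rw [MeasureTheory.integral_finsetSum _ hint]
  have hj : ∀ j ∈ univ (α := J), (2 / 3 : ℝ) ≤ ∫ ω, (S j).indicator (fun _ => (1 : ℝ)) ω ∂μ := by
    intro j _
    rw [MeasureTheory.integral_indicator_const _ (hS j), smul_eq_mul, mul_one]
    have h := ENNReal.toReal_mono (MeasureTheory.measure_ne_top μ (S j)) (hμ j)
    simpa [MeasureTheory.Measure.real] using h
  have h := Finset.card_nsmul_le_sum univ _ _ hj
  rw [nsmul_eq_mul, Finset.card_univ] at h
  linarith

/-- An algorithm that decides disjointness of two inputs hidden on the two sides of a cut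
needs to send many bits across the cut. -/
theorem card_le_of_decides_disjointness {Ω : Type*} {n B : ℕ} [MeasurableSpace Ω]
    (μ : MeasureTheory.Measure Ω) [MeasureTheory.IsProbabilityMeasure μ]
    (A : CongestAlgorithm Ω n B) (T : ℕ) {ι K : Type*} [Fintype ι] [DecidableEq ι] [Fintype K]
    {G : (ι → Bool) → (ι → Bool) → SimpleGraph (Fin n)} {side : Fin n → Bool}
    {cut : K → Fin n × Fin n} (h : IsCutFamily G side cut) (v : Fin n) (hv : side v = false)
    (θ : ℝ) (hdec : ∀ x y, ∃ S : Set Ω, MeasurableSet S ∧ 2 / 3 ≤ μ S ∧ ∀ ω ∈ S,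
      (A.output (A.stateAfter (G x y) ω T v) ≤ θ ↔ ∀ i, x i = false ∨ y i = false)) :
    (Fintype.card ι : ℝ) ≤
      576 * (Real.log 2 * (1 + (B + 1) * (T * Fintype.card K))) := by
  classical
  choose S hS hμ hdec using hdec
  -- Averaging over the hard distribution fixes one seed, making the algorithm deterministic.
  obtain ⟨ω, hω⟩ := exists_two_thirds_le_sum_indicator μ
    (fun j : ι × (ι → Bool) × (ι → Bool) × Bool =>
      S (Function.update (selectBits j.2.1 j.2.2.1) j.1 j.2.2.2)
        (Function.update (rejectBits j.2.1 j.2.2.1) j.1 j.2.2.2))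
    (fun _ => hS _ _) (fun _ => hμ _ _)
  -- The answer of `v` is appended as one more bit. Since `v` lies on the first player's side, the
  -- rectangle property survives.
  set tr : (ι → Bool) → (ι → Bool) → (Fin T → K → CongestMessage B) × Bool := fun x y =>
    (A.cutTranscript ω T G cut x y, decide (A.output (A.stateAfter (G x y) ω T v) ≤ θ)) with htr
  have hrect : ∀ x y x' y', tr x y = tr x' y' → tr x y' = tr x y := by
    intro x y x' y' heq
    have heq := (Prod.ext_iff.1 heq).1
    simp only [htr]
    rw [cutTranscript_rectangle A ω h heq,
      (stateAfter_of_cutTranscript_eq A ω h heq T le_rfl).1 v hv]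
  have hmain := card_le_log_card_transcripts (tr := tr) hrect (univ.filter fun z => z.2 = true) (by
    simp only [Fintype.sum_prod_type, Fintype.sum_bool, Fintype.card_prod, Fintype.card_fun,
      Fintype.card_bool] at hω
    push_cast at hω
    refine le_trans (by linarith) (hω.trans ?_)
    refine Finset.sum_le_sum fun i _ => Finset.sum_le_sum fun d _ =>
      Finset.sum_le_sum fun w _ => ?_
    rw [add_comm]
    refine add_le_add ?_ ?_
    · refine Set.indicator_apply_le' (fun hmem => ?_) (fun _ => by split_ifs <;> norm_num)
      have hle := (hdec _ _ ω hmem).2 fun j => by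
        by_cases hj : j = i
        · left; simp [hj]
        · simp only [Function.update_of_ne hj, selectBits, rejectBits]
          cases d j <;> simp
      simp [htr, hle]
    · refine Set.indicator_apply_le' (fun hmem => ?_) (fun _ => by split_ifs <;> norm_num)
      have hnle := mt (hdec _ _ ω hmem).1 fun hall => by simpa using hall i
      simp [htr, lt_of_not_ge hnle])
  refine hmain.trans ?_
  refine mul_le_mul_of_nonneg_left ?_ (by norm_num)
  have hcard : Fintype.card ((Fin T → K → CongestMessage B) × Bool) ≤
      2 ^ (1 + (B + 1) * (T * Fintype.card K)) := by
    rw [Fintype.card_prod, Fintype.card_fun, Fintype.card_fun, Fintype.card_bool, Fintype.card_fin,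
      ← pow_mul, pow_add, pow_one, mul_comm, pow_mul 2, mul_comm (Fintype.card K)]
    exact Nat.mul_le_mul_left _ (Nat.pow_le_pow_left (CongestMessage.card_le B) _)
  have hpos : 0 < Fintype.card ((Fin T → K → CongestMessage B) × Bool) := by
    have : Nonempty (CongestMessage B) := ⟨CongestMessage.empty B⟩
    exact Fintype.card_pos
  have hlog := Real.log_le_log (by exact_mod_cast hpos) (Nat.cast_le (α := ℝ) |>.2 hcard)
  refine hlog.trans (le_of_eq ?_)
  push_cast
  rw [Real.log_pow]
  push_cast
  ring

end CongestAlgorithm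

/-! ### The cut of the spider graph and the resulting networks. -/

namespace SpiderNode

variable {L P W n : ℕ}

/-- The side of the cut to which a node belongs. -/
def side : SpiderNode L P W → Bool
  | centre s _ => s
  | leg s _ _ _ => s
  | hub s _ _ => s
  | pad _ => false

/-- The edges across the cut. -/
def cutPair : Bool × Option (Fin (L + 1) × Bool) → SpiderNode L P W × SpiderNode L P W
  | (s, none) => (centre s 0, centre (!s) 0)
  | (s, some (j, b)) => (hub s j b, hub (!s) j b)

theorem cutPair_not (s : Bool) (o : Option (Fin (L + 1) × Bool)) :
    cutPair (P := P) (W := W) (!s, o) = (cutPair (s, o)).swap := by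
  cases o <;> simp [cutPair]

theorem parent_congr {z z' : Bool → Fin (2 ^ L) → Bool} {v : SpiderNode L P W}
    (h : z (side v) = z' (side v)) : parent z v = parent z' v := by
  cases v <;> simp_all [parent, side]

theorem adj_congr {z z' : Bool → Fin (2 ^ L) → Bool} {u v : SpiderNode L P W}
    (hu : z (side u) = z' (side u)) (hv : z (side v) = z' (side v)) :
    (graph L P W z).Adj u v ↔ (graph L P W z').Adj u v := by
  simp only [graph, SimpleGraph.fromRel_adj, parent_congr hu, parent_congr hv]

theorem adj_cutPair (z : Bool → Fin (2 ^ L) → Bool) (k : Bool × Option (Fin (L + 1) × Bool)) :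
    (graph L P W z).Adj (cutPair k).1 (cutPair k).2 := by
  rw [graph, SimpleGraph.fromRel_adj]
  rcases k with ⟨s, _ | ⟨j, b⟩⟩ <;> simp [cutPair, parent, parent']

theorem exists_cutPair_of_parent {z : Bool → Fin (2 ^ L) → Bool} {u v : SpiderNode L P W}
    (h : v = parent z u ∨ v = parent' u) (hside : side u ≠ side v) : ∃ k, cutPair k = (u, v) := by
  cases u with
  | centre s i =>
    rcases h with rfl | rfl
    · simp only [parent] at hside
      split_ifs at hside <;> simp [side] at hside
    · by_cases hi : i = 0
      · exact ⟨(s, none), by simp [cutPair, parent', hi]⟩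
      · simp [parent', hi] at hside
  | leg s i j p =>
    rcases h with rfl | rfl
    · simp only [parent] at hside
      split_ifs at hside <;> simp [side] at hside
    · simp only [parent'] at hside
      split_ifs at hside <;> simp [side] at hside
  | hub s j b =>
    rcases h with rfl | rfl
    · exact ⟨(s, some (j, b)), by simp [cutPair, parent]⟩
    · simp [parent'] at hside
  | pad q => rcases h with rfl | rfl <;> simp [parent, parent', side] at hside

theorem exists_cutPair {z : Bool → Fin (2 ^ L) → Bool} {u v : SpiderNode L P W}
    (h : (graph L P W z).Adj u v) (hside : side u ≠ side v) : ∃ k, cutPair k = (u, v) := by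
  rw [graph, SimpleGraph.fromRel_adj] at h
  rcases h.2 with h | h
  · exact exists_cutPair_of_parent h hside
  · obtain ⟨⟨s, o⟩, hk⟩ := exists_cutPair_of_parent h hside.symm
    exact ⟨(!s, o), by rw [cutPair_not, hk, Prod.swap_prod_mk]⟩

/-- The marks that encode a pair of inputs. Spider `0` is never marked. -/
def marks (x y : {i : Fin (2 ^ L) // i ≠ 0} → Bool) (s : Bool) (i : Fin (2 ^ L)) : Bool :=
  if h : i ≠ 0 then (if s then y ⟨i, h⟩ else x ⟨i, h⟩) else false

/-- The lower bound graph for a pair of inputs, with the nodes numbered by `e`. -/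
def network (e : Fin n ≃ SpiderNode L P W) (x y : {i : Fin (2 ^ L) // i ≠ 0} → Bool) :
    SimpleGraph (Fin n) :=
  (graph L P W (marks x y)).comap e

theorem isCutFamily_network (e : Fin n ≃ SpiderNode L P W) :
    CongestAlgorithm.IsCutFamily (network e) (fun v => side (e v))
      (fun k => Prod.map e.symm e.symm (cutPair k)) where
  left x y y' u v hu hv := by
    have h : marks x y false = marks x y' false := by ext i; simp [marks]
    exact adj_congr (by rw [hu, h]) (by rw [hv, h])
  right x x' y u v hu hv := by
    have h : marks x y true = marks x' y true := by ext i; simp [marks]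
    exact adj_congr (by rw [hu, h]) (by rw [hv, h])
  across x y x' y' u v huv := by
    -- Every crossing edge is a `cutPair`, and these are edges for all marks.
    have key : ∀ z z', (graph L P W z).Adj (e u) (e v) → (graph L P W z').Adj (e u) (e v) := by
      intro z z' h
      obtain ⟨k, hk⟩ := exists_cutPair h huv
      have := adj_cutPair (P := P) (W := W) z' k
      rwa [hk] at this
    exact ⟨key _ _, key _ _⟩
  exists_cut x y u v huv h := by
    obtain ⟨k, hk⟩ := exists_cutPair h huv
    exact ⟨k, by simp [hk]⟩

theorem ediam_network (e : Fin n ≃ SpiderNode L P W) (x y : {i : Fin (2 ^ L) // i ≠ 0} → Bool) :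
    (network e x y).ediam = (graph L P W (marks x y)).ediam :=
  ediam_comap_equiv _ e

theorem network_mem_sparseNetworks (hP : 0 < P) (e : Fin n ≃ SpiderNode L P W)
    (x y : {i : Fin (2 ^ L) // i ≠ 0} → Bool) : network e x y ∈ sparseNetworks 2 (6 * P + 9) n := by
  have hle : (network e x y).ediam ≤ ((6 * P + 9 : ℕ) : ℕ∞) := by
    rw [ediam_network]; exact ediam_le _ hP
  have : Nonempty (Fin n) := ⟨e.symm (centre false 0)⟩
  refine ⟨SimpleGraph.connected_of_ediam_ne_top
    (ne_top_of_le_ne_top (ENat.natCast_ne_top _) hle), ?_, ?_⟩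
  · have h := ncard_edgeSet_le_of_adj_imp (network e x y)
      (fun v => e.symm (parent (marks x y) (e v))) (fun v => e.symm (parent' (e v)))
      (fun u v h => by
        simp only [Equiv.eq_symm_apply]
        exact adj_imp h)
    simpa using h
  · exact ENat.toNat_le_of_le_natCast hle

theorem diam_network_le_of_disjoint (hP : 0 < P) (e : Fin n ≃ SpiderNode L P W)
    {x y : {i : Fin (2 ^ L) // i ≠ 0} → Bool} (h : ∀ i, x i = false ∨ y i = false) :
    (network e x y).diam ≤ 4 * P + 8 := by
  refine ENat.toNat_le_of_le_natCast ?_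
  rw [ediam_network]
  refine ediam_le_of_disjoint _ hP fun i => ?_
  by_cases hi : i = 0
  · simp [marks, hi]
  · simpa [marks, hi] using h ⟨i, hi⟩

theorem le_diam_network_of_not_disjoint (hP : 0 < P) (e : Fin n ≃ SpiderNode L P W)
    {x y : {i : Fin (2 ^ L) // i ≠ 0} → Bool} (h : ¬ ∀ i, x i = false ∨ y i = false) :
    6 * P + 4 ≤ (network e x y).diam := by
  push Not at h
  obtain ⟨⟨i, hi⟩, h⟩ := h
  have := le_diam_of_not_disjoint (L := L) (W := W) (z := marks x y) hP hi
    (fun s => by cases s <;> simp_all [marks])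
  rwa [SimpleGraph.diam, ediam_network]

theorem exists_equiv (hn : 10 * P * (2 ^ L * (L + 1)) ≤ n) (hP : 0 < P) :
    ∃ W, Nonempty (Fin n ≃ SpiderNode L P W) := by
  have h1 : L + 1 ≤ 2 ^ L := Nat.lt_two_pow_self
  have hle : 2 * 2 ^ L + (2 * (2 ^ L * ((L + 2) * P)) + 2 * ((L + 1) * 2)) ≤ n := by
    refine le_trans ?_ hn
    have h2 : 2 ^ L * 1 ≤ 2 ^ L * (P * (L + 1)) :=
      Nat.mul_le_mul_left _ (Nat.mul_pos hP (Nat.succ_pos L))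
    have h3 : 2 ^ L * ((L + 2) * P) ≤ 2 ^ L * (2 * (P * (L + 1))) :=
      Nat.mul_le_mul_left _ (by nlinarith)
    nlinarith
  refine ⟨n - (2 * 2 ^ L + (2 * (2 ^ L * ((L + 2) * P)) + 2 * ((L + 1) * 2))), ⟨?_⟩⟩
  refine (Fintype.equivFinOfCardEq ?_).symm.trans (equivSum L P _).symm
  simp only [Fintype.card_sum, Fintype.card_prod, Fintype.card_bool, Fintype.card_fin]
  omega

end SpiderNode

/-! ### Choice of parameters and conclusion. -/

/-- At `d = 4 P + 8` the gain `4 ε P` absorbs the excess `8 + β`. If `ε > 3/2` the product is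
nonpositive and `β ≤ P` suffices. -/
theorem three_halves_sub_mul_add_lt {ε β : ℝ} (hε : 0 < ε) {P : ℕ} (hβ : |β| ≤ P)
    (hP : (8 + |β|) / ε ≤ P) {d : ℕ} (hd : d ≤ 4 * P + 8) :
    (3 / 2 - ε) * d + β < 6 * P + 4 := by
  have hd' : (d : ℝ) ≤ 4 * P + 8 := by exact_mod_cast hd
  have hd0 : (0 : ℝ) ≤ d := by positivity
  have hP0 : (0 : ℝ) ≤ P := by positivity
  have hb := le_abs_self β
  rw [div_le_iff₀ hε] at hP
  rcases le_or_gt 0 (3 / 2 - ε) with h | h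
  · nlinarith
  · nlinarith

/-- The lower bound for the networks with `2 ^ L` spiders on either side. -/
theorem two_pow_sub_one_le_of_approximatesDiam {ε β : ℝ} (hε : 0 < ε) {P : ℕ} (hP : 0 < P)
    (hβ : |β| ≤ P) (hPε : (8 + |β|) / ε ≤ P) {n B L : ℕ} (hn : 10 * P * (2 ^ L * (L + 1)) ≤ n)
    {Ω : Type*} [MeasurableSpace Ω] (μ : MeasureTheory.Measure Ω)
    [MeasureTheory.IsProbabilityMeasure μ] (A : CongestAlgorithm Ω n B) (T : ℕ)
    (hA : A.ApproximatesDiam μ T (3 / 2 - ε) β (sparseNetworks 2 (6 * P + 9) n)) :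
    (2 : ℝ) ^ L - 1 ≤ 576 * (Real.log 2 * (1 + (B + 1) * (T * (4 * L + 6)))) := by
  obtain ⟨W, ⟨e⟩⟩ := SpiderNode.exists_equiv hn hP
  -- The threshold is a maximum over all small diameters, since the coefficient `3/2 - ε` may be
  -- negative.
  obtain ⟨θ, hθ, hθ'⟩ : ∃ θ : ℝ, θ < 6 * P + 4 ∧
      ∀ d : ℕ, d ≤ 4 * P + 8 → (3 / 2 - ε) * d + β ≤ θ := by
    have hne : (Finset.range (4 * P + 9)).Nonempty := ⟨0, by simp⟩
    refine ⟨(Finset.range (4 * P + 9)).sup' hne fun d => (3 / 2 - ε) * (d : ℝ) + β, ?_, ?_⟩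
    · rw [Finset.sup'_lt_iff]
      intro d hd
      exact three_halves_sub_mul_add_lt hε hβ hPε (by rw [Finset.mem_range] at hd; omega)
    · intro d hd
      exact Finset.le_sup' (fun d : ℕ => (3 / 2 - ε) * (d : ℝ) + β)
        (by rw [Finset.mem_range]; omega)
  have h := CongestAlgorithm.card_le_of_decides_disjointness μ A T
    (SpiderNode.isCutFamily_network e) (e.symm (SpiderNode.centre false 0))
    (by simp [SpiderNode.side]) θ (fun x y => by
      obtain ⟨S, hS, hμ, hout⟩ := hA _ (SpiderNode.network_mem_sparseNetworks hP e x y)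
      refine ⟨S, hS, hμ, fun ω hω => ?_⟩
      obtain ⟨hlow, hup⟩ := hout ω hω (e.symm (SpiderNode.centre false 0))
      constructor
      · intro hle
        by_contra hdisj
        have hd := SpiderNode.le_diam_network_of_not_disjoint hP e hdisj
        have hd' : (6 * P + 4 : ℝ) ≤ (SpiderNode.network e x y).diam := by exact_mod_cast hd
        linarith
      · intro hdisj
        exact hup.trans (hθ' _ (SpiderNode.diam_network_le_of_disjoint hP e hdisj)))
  have hcard : (Fintype.card {i : Fin (2 ^ L) // i ≠ 0} : ℝ) = 2 ^ L - 1 := by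
    have h1 : Fintype.card {i : Fin (2 ^ L) // i ≠ 0} + 1 = 2 ^ L := by
      have := Fintype.card_subtype_compl fun i : Fin (2 ^ L) => i = 0
      simp only [Fintype.card_unique, Fintype.card_fin] at this
      have hp : 0 < 2 ^ L := by positivity
      simp only [ne_eq]
      omega
    have h2 : (Fintype.card {i : Fin (2 ^ L) // i ≠ 0} : ℝ) + 1 = 2 ^ L := by exact_mod_cast h1
    linarith
  rw [hcard] at h
  refine h.trans (le_of_eq ?_)
  simp only [Fintype.card_prod, Fintype.card_option, Fintype.card_bool, Fintype.card_fin]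
  push_cast
  ring

/-- Passing from `L` to `L + 1` multiplies `2 ^ L * (L + 1)` by at most 4. -/
theorem exists_maximal_dimension {M n : ℕ} (hn : M ≤ n) (hM : 0 < M) :
    ∃ L : ℕ, M * (2 ^ L * (L + 1)) ≤ n ∧ n < 4 * M * (2 ^ L * (L + 1)) := by
  have hex : ∃ L : ℕ, n < M * (2 ^ L * (L + 1)) := by
    refine ⟨n, ?_⟩
    have h1 : n < 2 ^ n := Nat.lt_two_pow_self
    have h2 : 2 ^ n * 1 ≤ 2 ^ n * (n + 1) := Nat.mul_le_mul_left _ (by omega)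
    have h3 : 1 * (2 ^ n * (n + 1)) ≤ M * (2 ^ n * (n + 1)) := Nat.mul_le_mul_right _ hM
    omega
  have hfind := Nat.find_spec hex
  have h0 : Nat.find hex ≠ 0 := by
    intro h
    rw [h] at hfind
    simp at hfind
    omega
  obtain ⟨L, hL⟩ := Nat.exists_eq_succ_of_ne_zero h0
  refine ⟨L, not_lt.1 (Nat.find_min hex (by omega)), ?_⟩
  rw [hL] at hfind
  refine hfind.trans_le ?_
  rw [mul_comm 4 M, mul_assoc]
  refine Nat.mul_le_mul_left _ ?_
  rw [Nat.succ_eq_add_one, pow_succ]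
  have : 2 ^ L * (L + 2) ≤ 2 ^ L * (2 * (L + 1)) := Nat.mul_le_mul_left _ (by omega)
  nlinarith

/-- The arithmetic that turns the bound in terms of the dimension `L` into a bound
in terms of `n`. -/
theorem div_log_pow_three_le {M n B L T : ℕ} {c : ℝ} (hc : 0 ≤ c) (hM : 0 < M)
    (hlog : 1 ≤ Real.log n) (hlarge : 577 * (24 * M) * Real.log n ≤ n)
    (hB : (B : ℝ) ≤ c * Real.log n) (hL : M * (2 ^ L * (L + 1)) ≤ n)
    (hL' : n < 4 * M * (2 ^ L * (L + 1)))
    (h : (2 : ℝ) ^ L - 1 ≤ 576 * (Real.log 2 * (1 + (B + 1) * (T * (4 * L + 6))))) :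
    1 / (24 * M * (10368 * (c + 1))) * ((n : ℝ) / Real.log n ^ 3) ≤ T := by
  set l := Real.log n with hl
  have hM' : (1 : ℝ) ≤ M := by exact_mod_cast hM
  have hLn : 2 ^ L ≤ n := by
    refine le_trans ?_ hL
    calc 2 ^ L = 1 * (2 ^ L * 1) := by ring
      _ ≤ M * (2 ^ L * (L + 1)) := by gcongr <;> omega
  have hLl : (L : ℝ) + 1 ≤ 3 * l := by
    have h1 : Real.log ((2 : ℝ) ^ L) ≤ l :=
      Real.log_le_log (by positivity) (by exact_mod_cast hLn)
    rw [Real.log_pow] at h1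
    have h2 := Real.log_two_gt_d9
    have h3 : (0 : ℝ) ≤ L := by positivity
    nlinarith
  have h1 : (n : ℝ) ≤ 12 * M * l * 2 ^ L := by
    have h2 : (n : ℝ) ≤ 4 * M * (2 ^ L * (L + 1)) := by exact_mod_cast hL'.le
    calc (n : ℝ) ≤ 4 * M * (2 ^ L * (L + 1)) := h2
      _ ≤ 4 * M * (2 ^ L * (3 * l)) := by gcongr
      _ = _ := by ring
  -- Here `4 L + 6 ≤ 6 (L + 1) ≤ 18 l`, and `10368 = 576 * 18`.
  have h2 : (2 : ℝ) ^ L ≤ 577 + 10368 * (c + 1) * l ^ 2 * T := by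
    have h3 : (B + 1) * (T * (4 * L + 6)) ≤ ((c + 1) * l) * (T * (18 * l)) := by
      gcongr
      · linarith
      · linarith
    have h4 : Real.log 2 * (1 + (B + 1) * (T * (4 * L + 6))) ≤
        1 * (1 + ((c + 1) * l) * (T * (18 * l))) := by
      have := Real.log_two_lt_d9
      gcongr
      linarith
    nlinarith
  -- By `hlarge` the constant 577 accounts for at most half of `n`.
  have h3 : (n : ℝ) ≤ 24 * M * l * (10368 * (c + 1) * l ^ 2 * T) := by
    have h4 := mul_le_mul_of_nonneg_left h2 (show 0 ≤ 12 * M * l by positivity)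
    nlinarith
  rw [div_mul_div_comm, one_mul, div_le_iff₀ (by positivity)]
  refine h3.trans (le_of_eq ?_)
  ring

theorem mainTheorem2 :
    ∃ s : ℕ, ∀ ε : ℝ, 0 < ε → ∀ β : ℝ, ∃ R : ℕ, ∀ c : ℝ, ∃ C : ℝ, 0 < C ∧ ∃ N : ℕ,
      ∀ n : ℕ, N ≤ n → ∀ B : ℕ, (B : ℝ) ≤ c * Real.log n →
        ∀ (Ω : Type u) [MeasurableSpace Ω] (μ : MeasureTheory.Measure Ω)
          [MeasureTheory.IsProbabilityMeasure μ]
          (A : CongestAlgorithm.{u, v} Ω n B) (T : ℕ),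
          A.ApproximatesDiam μ T (3 / 2 - ε) β (sparseNetworks s R n) →
            C * ((n : ℝ) / Real.log n ^ 3) ≤ (T : ℝ) := by
  refine ⟨2, fun ε hε β => ?_⟩
  obtain ⟨P, hP⟩ := exists_nat_ge (max 1 (max |β| ((8 + |β|) / ε)))
  obtain ⟨hP1, hP'⟩ := max_le_iff.1 hP
  obtain ⟨hPβ, hPε⟩ := max_le_iff.1 hP'
  have hPpos : 0 < P := by
    have : (0 : ℝ) < P := by linarith
    exact_mod_cast this
  have hMpos : 0 < 10 * P := by omega
  refine ⟨6 * P + 9, fun c => ⟨1 / (24 * (10 * P : ℕ) * (10368 * (|c| + 1))), by positivity, ?_⟩⟩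
  have hlarge : ∀ᶠ n : ℕ in Filter.atTop,
      1 ≤ Real.log n ∧ 577 * (24 * (10 * P : ℕ)) * Real.log n ≤ n ∧ 10 * P ≤ n := by
    have hpos : (0 : ℝ) < 577 * (24 * (10 * P : ℕ)) := by positivity
    have h1 := (Real.isLittleO_log_id_atTop.bound (inv_pos.2 hpos)).natCast_atTop
    have h2 := (Real.tendsto_log_atTop.comp tendsto_natCast_atTop_atTop).eventually_ge_atTop 1
    filter_upwards [h1, h2, Filter.eventually_ge_atTop (10 * P)] with n h1 h2 h3
    refine ⟨h2, ?_, h3⟩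
    have h4 := (le_abs_self _).trans h1
    rw [id, Real.norm_of_nonneg (Nat.cast_nonneg n), ← div_eq_inv_mul, le_div_iff₀ hpos] at h4
    linarith
  obtain ⟨N, hN⟩ := Filter.eventually_atTop.1 hlarge
  refine ⟨N, fun n hn B hB Ω _ μ _ A T hA => ?_⟩
  obtain ⟨hlog, hnlarge, hMn⟩ := hN n hn
  obtain ⟨L, hL, hL'⟩ := exists_maximal_dimension hMn hMpos
  have hBc : (B : ℝ) ≤ |c| * Real.log n :=
    hB.trans (mul_le_mul_of_nonneg_right (le_abs_self c) (by linarith))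
  exact div_log_pow_three_le (abs_nonneg c) hMpos hlog hnlarge hBc hL hL'
    (two_pow_sub_one_le_of_approximatesDiam hε hPpos hPβ hPε hL μ A T hA)
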